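/- Let $k$ be a field. Consider standard graded artinian Gorenstein $k$-algebras, that is, quotients $A=k[x_1,\dots,x_n]/I$ by a homogeneous ideal $I$ such that $A$ is artinian and its socle $0:_A(x_1,\dots,x_n)$ has dimension one over $k$. The $h$-vector of $A$ is $(h_0,h_1,\dots,h_e)$, where $h_i=\dim_k A_i$ and $e$, the socle degree of $A$, is the largest degree with $A_e\neq 0$; the codimension of $A$ is $h_1$. Such a tuple is called a Gorenstein $h$-vector; it is unimodal if it never strictly increases after a strict decrease. For integers $r\ge 2$ and $e\ge 4$ let $f(r,e)$ be the least value of $h_2$ among all Gorenstein $h$-vectors over $k$ of codimension $r$ and socle degree $e$. (i) If $2\le r\le 9$, then $f(r,e)=r$ for all $e\ge 4$. Moreover, every Gorenstein $h$-vector of socle degree $4$ and codimension at most $9$ is unimodal. (ii) If $2\le r\le 13$, then $f(r,5)=r$. Moreover, every Gorenstein $h$-vector of socle degree $5$ and codimension at most $13$ is unimodal. -/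

import Mathlib

open MvPolynomial

noncomputable section

namespace GorensteinHVector

attribute [local instance] MvPolynomial.gradedAlgebra

/-- The degree `i` component `A_i` of the standard graded algebra `A = k[x_1, …, x_n] / I`,
where `I` is a homogeneous ideal: the image in `A` of the forms of degree `i`. -/
def gradedPiece {k : Type*} [Field k] {n : ℕ} (I : Ideal (MvPolynomial (Fin n) k)) (i : ℕ) :
    Submodule k (MvPolynomial (Fin n) k ⧸ I) :=
  (homogeneousSubmodule (Fin n) k i).map (Ideal.Quotient.mkₐ k I).toLinearMap

/-- The Hilbert function `i ↦ dim_k A_i` of `A = k[x_1, …, x_n] / I`. -/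
def hilbertFunction {k : Type*} [Field k] {n : ℕ} (I : Ideal (MvPolynomial (Fin n) k))
    (i : ℕ) : ℕ :=
  Module.finrank k (gradedPiece I i)

/-- The socle `0 :_A (x_1, …, x_n)` of `A = k[x_1, …, x_n] / I`: the elements of `A` that are
annihilated by the homogeneous maximal ideal, that is, by every variable. -/
def socle {k : Type*} [Field k] {n : ℕ} (I : Ideal (MvPolynomial (Fin n) k)) :
    Submodule k (MvPolynomial (Fin n) k ⧸ I) where
  carrier := {a | ∀ j : Fin n, Ideal.Quotient.mk I (X j) * a = 0}
  add_mem' := by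
    intro a b ha hb j
    rw [mul_add, ha j, hb j, add_zero]
  zero_mem' := by
    intro j
    rw [mul_zero]
  smul_mem' := by
    intro c a ha j
    rw [mul_smul_comm, ha j, smul_zero]

/-- `A = k[x_1, …, x_n] / I` is a standard graded artinian Gorenstein `k`-algebra:
`I` is homogeneous, `A` is artinian, and the socle of `A` is one-dimensional over `k`. -/
structure IsArtinianGorenstein {k : Type*} [Field k] {n : ℕ}
    (I : Ideal (MvPolynomial (Fin n) k)) : Prop where
  homogeneous : I.IsHomogeneous (homogeneousSubmodule (Fin n) k)
  artinian : IsArtinianRing (MvPolynomial (Fin n) k ⧸ I)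
  socle_finrank : Module.finrank k (socle I) = 1

/-- `h = (h_0, …, h_e)` is the `h`-vector of a standard graded artinian Gorenstein `k`-algebra
of socle degree `e`. The tuple is extended by zero to a function on `ℕ`, so that it is the
Hilbert function of the algebra, and `e` is the last degree in which it does not vanish. -/
def IsGorensteinHVector (k : Type*) [Field k] (e : ℕ) (h : ℕ → ℕ) : Prop :=
  (∃ (n : ℕ) (I : Ideal (MvPolynomial (Fin n) k)),
    IsArtinianGorenstein I ∧ ∀ i, h i = hilbertFunction I i) ∧
  0 < h e ∧ ∀ i, e < i → h i = 0

/-- The least value of the degree two entry `h_2` among the Gorenstein `h`-vectors over `k` of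
codimension `h_1 = r` and socle degree `e`. The infimum is taken in `ℕ`: it is attained if
there is such a vector, and it is `0` otherwise. -/
def f (k : Type*) [Field k] (r e : ℕ) : ℕ :=
  sInf {m : ℕ | ∃ h : ℕ → ℕ, IsGorensteinHVector k e h ∧ h 1 = r ∧ h 2 = m}

/-- `(h_0, …, h_e)` is unimodal: it never strictly increases after a strict decrease. -/
def IsUnimodal (e : ℕ) (h : ℕ → ℕ) : Prop :=
  ∀ i j : ℕ, i < j → j < e → h (i + 1) < h i → h (j + 1) ≤ h j

end GorensteinHVector

end

/-!
Let `A` be a Gorenstein algebra of socle degree `e`. By Macaulay duality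
(`IsArtinianGorenstein.exists_functional`) its Hilbert function consists of the ranks of the
pairings `(p, q) ↦ φ (p q)` on forms of degrees `i` and `e - i`, for a functional `φ` on the
polynomial ring. In particular it is symmetric, and since these ranks are ranks of catalecticant
matrices, they survive an extension of the field (`pairingRank_extendFunctional`); so the field
may be taken to be infinite.

The claim is then `h 1 ≤ h 2`. For a linear form `x`, symmetry shows that multiplication by `x`
has the same rank from degree `1` to degree `2` as from degree `e - 2` to degree `e - 1`. Hence
`h 2 - h (e - 1) = dim (A / x A)_2 - dim (A / x A)_(e - 1)`, where `h (e - 1) = h 1`.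
For general `x`, Green's hyperplane restriction theorem bounds `dim (A / x A)_(e - 1)` by `3`,
because `h (e - 1) ≤ 9` and `e - 1 ≥ 3`, or `h (e - 1) ≤ 13` and `e - 1 = 4`.
If `dim (A / x A)_2 ≥ 3`, this suffices; otherwise Macaulay's bound (`codim_le_of_codim_le_two`)
excludes growth from degree `2` on (`pairingRank_one_le_pairingRank_two`).

Green's theorem is proved in the recursive form `GreenBound.succ`: the restricted codimension `c`
of a space of forms of codimension `H` satisfies `c ≤ B' (H - c) + B c`, where `B` and `B'` are
bounds in the given degree and in the one below. The few values that are needed are tabulated in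
`boundTwo`, `boundThree` and `boundFour`.

The value `h 2 = h 1 = r` is attained by the algebra dual to `x₁ᵉ + ⋯ + xᵣᵉ`
(`exists_isGorensteinHVector`), in every characteristic when divided powers are used.
-/

namespace GorensteinHVector

attribute [local instance] MvPolynomial.gradedAlgebra

open Module

/-! ### Codimensions and generic ranks -/

section LinearAlgebra

variable {K M N : Type*} [Field K] [AddCommGroup M] [Module K M] [AddCommGroup N] [Module K N]

/-- The dimension of `T / (T ∩ W)`, where `W` need not be contained in `T`. -/
noncomputable def codim (W T : Submodule K M) : ℕ :=
  finrank K (T.map W.mkQ)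

theorem finrank_map_add_finrank_inf_ker (f : M →ₗ[K] N) (T : Submodule K M)
    [FiniteDimensional K T] :
    finrank K (T.map f) + finrank K ↥(T ⊓ LinearMap.ker f) = finrank K T := by
  have h := (f.domRestrict T).finrank_range_add_finrank_ker
  rw [LinearMap.range_domRestrict] at h
  rw [← h, LinearMap.ker_domRestrict]
  congr 1
  rw [← Submodule.map_comap_subtype]
  exact (Submodule.equivMapOfInjective T.subtype T.injective_subtype _).finrank_eq.symm

theorem codim_add_finrank_inf (W T : Submodule K M) [FiniteDimensional K T] :
    codim W T + finrank K ↥(T ⊓ W) = finrank K T := by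
  have h := finrank_map_add_finrank_inf_ker W.mkQ T
  rwa [W.ker_mkQ] at h

theorem codim_add_finrank {W T : Submodule K M} [FiniteDimensional K T] (h : W ≤ T) :
    codim W T + finrank K W = finrank K T := by
  have h' := codim_add_finrank_inf W T
  rwa [inf_eq_right.mpr h] at h'

theorem codim_eq_finrank_map {W T : Submodule K M} [FiniteDimensional K T] (f : M →ₗ[K] N)
    (h : ∀ p ∈ T, p ∈ W ↔ f p = 0) : codim W T = finrank K (T.map f) := by
  have h1 := codim_add_finrank_inf W T
  have h2 := finrank_map_add_finrank_inf_ker f T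
  have h3 : T ⊓ W = T ⊓ LinearMap.ker f := by
    ext p
    simp only [Submodule.mem_inf, LinearMap.mem_ker]
    exact and_congr_right (h p)
  rw [h3] at h1
  omega

theorem codim_anti {W W' T : Submodule K M} [FiniteDimensional K T] (h : W ≤ W') :
    codim W' T ≤ codim W T := by
  have h1 := codim_add_finrank_inf W T
  have h2 := codim_add_finrank_inf W' T
  have : FiniteDimensional K ↥(T ⊓ W') := Submodule.finiteDimensional_inf_left T W'
  have h3 : finrank K ↥(T ⊓ W) ≤ finrank K ↥(T ⊓ W') :=
    Submodule.finrank_mono (inf_le_inf_left T h)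
  omega

theorem le_of_codim_eq_zero {W T : Submodule K M} [FiniteDimensional K T] (h : codim W T = 0) :
    T ≤ W := by
  have : T.map W.mkQ = ⊥ := Submodule.finrank_eq_zero.mp h
  rwa [← W.ker_mkQ, LinearMap.le_ker_iff_map]

theorem codim_eq_zero {W T : Submodule K M} (h : T ≤ W) : codim W T = 0 := by
  have : T.map W.mkQ = ⊥ := by rwa [← LinearMap.le_ker_iff_map, W.ker_mkQ]
  rw [codim, this, finrank_bot]

/-- The rank of the composite `U → T / W` measures the drop in codimension when the image of `U`
is added to `W`. -/
theorem codim_sup_map_add_finrank {W T : Submodule K M} [FiniteDimensional K T] (hW : W ≤ T)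
    (g : N →ₗ[K] M) (U : Submodule K N) (hU : U.map g ≤ T) :
    codim (W ⊔ U.map g) T + finrank K (U.map (W.mkQ ∘ₗ g)) = codim W T := by
  have h1 := codim_add_finrank hW
  have h2 := codim_add_finrank (sup_le hW hU)
  have : FiniteDimensional K ↥(W ⊔ U.map g) := Submodule.finiteDimensional_of_le (sup_le hW hU)
  have h3 := codim_add_finrank (le_sup_left : W ≤ W ⊔ U.map g)
  have h4 : codim W (W ⊔ U.map g) = finrank K (U.map (W.mkQ ∘ₗ g)) := by
    rw [codim, Submodule.map_sup, Submodule.map_comp, Submodule.mkQ_map_self, bot_sup_eq]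
  omega

/-- The exact sequence `0 → U / (W : g) → T / W → T / (W + g U) → 0` in terms of dimensions. -/
theorem codim_comap_add_codim_sup {W T : Submodule K M} [FiniteDimensional K T] (hW : W ≤ T)
    (g : N →ₗ[K] M) (U : Submodule K N) [FiniteDimensional K U] (hU : U.map g ≤ T) :
    codim (W.comap g) U + codim (W ⊔ U.map g) T = codim W T := by
  rw [codim_eq_finrank_map (W := W.comap g) (W.mkQ ∘ₗ g) (by simp), add_comm]
  exact codim_sup_map_add_finrank hW g U hU

/-- Lower semicontinuity of the rank along a line. -/
theorem finite_setOf_finrank_range_lt [FiniteDimensional K M] (A B : M →ₗ[K] N) :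
    {t : K | finrank K (LinearMap.range (A + t • B)) < finrank K (LinearMap.range A)}.Finite := by
  -- A section `s` of `A` over its range `R` and a projection `p` onto `R` turn `A + t B` into the
  -- endomorphism `1 + t p B s` of `R`; it is injective unless `-1 / t` is an eigenvalue of `p B s`.
  obtain ⟨s, hs⟩ := A.rangeRestrict.exists_rightInverse_of_surjective A.range_rangeRestrict
  obtain ⟨p, hp⟩ := (LinearMap.range A).subtype.exists_leftInverse_of_injective
    (LinearMap.range A).ker_subtype
  set E : End K (LinearMap.range A) := p ∘ₗ B ∘ₗ s with hE
  refine (E.finite_hasEigenvalue.image fun μ => -μ⁻¹).subset fun t ht => ?_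
  have hps : ∀ v, p (A (s v)) = v := fun v => by
    have h1 : (LinearMap.range A).subtype (A.rangeRestrict (s v)) = A (s v) := rfl
    rw [← h1, ← LinearMap.comp_apply, hp, LinearMap.id_apply, ← LinearMap.comp_apply, hs,
      LinearMap.id_apply]
  have hni : ¬ Function.Injective (p ∘ₗ (A + t • B) ∘ₗ s) := fun hinj => by
    have h1 : Function.Injective ((A + t • B) ∘ₗ s) := by
      rw [LinearMap.coe_comp] at hinj
      exact hinj.of_comp
    have h2 := LinearMap.finrank_range_of_inj h1
    have h3 : finrank K (LinearMap.range ((A + t • B) ∘ₗ s))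
        ≤ finrank K (LinearMap.range (A + t • B)) :=
      Submodule.finrank_mono (LinearMap.range_comp_le_range _ _)
    have h4 : finrank K (LinearMap.range (A + t • B)) < finrank K (LinearMap.range A) := ht
    omega
  rw [← LinearMap.ker_eq_bot, Submodule.eq_bot_iff] at hni
  push Not at hni
  obtain ⟨v, hv, hv0⟩ := hni
  have hv' : v + t • E v = 0 := by
    simpa [hE, hps] using hv
  have ht0 : t ≠ 0 := by
    rintro rfl
    simp at hv'
    exact hv0 hv'
  refine ⟨-t⁻¹, End.hasEigenvalue_of_hasEigenvector (x := v) ⟨?_, hv0⟩, by simp⟩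
  rw [End.mem_eigenspace_iff, neg_smul, eq_neg_iff_add_eq_zero]
  have := congrArg (t⁻¹ • ·) hv'
  simp only [smul_add, smul_smul, inv_mul_cancel₀ ht0, one_smul, smul_zero] at this
  rwa [add_comm] at this

/-- Over an infinite field, two families of linear maps that depend linearly on a parameter in
`V` can be given ranks as large as at prescribed parameters by one and the same parameter. -/
theorem exists_finrank_range_ge [Infinite K] {U₁ U₂ Q₁ Q₂ : Type*}
    [AddCommGroup U₁] [Module K U₁] [FiniteDimensional K U₁]
    [AddCommGroup U₂] [Module K U₂] [FiniteDimensional K U₂]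
    [AddCommGroup Q₁] [Module K Q₁] [AddCommGroup Q₂] [Module K Q₂]
    (F₁ : M →ₗ[K] U₁ →ₗ[K] Q₁) (F₂ : M →ₗ[K] U₂ →ₗ[K] Q₂) {V : Submodule K M} {x₁ x₂ : M}
    (h₁ : x₁ ∈ V) (h₂ : x₂ ∈ V) :
    ∃ x ∈ V, finrank K (LinearMap.range (F₁ x₁)) ≤ finrank K (LinearMap.range (F₁ x)) ∧
      finrank K (LinearMap.range (F₂ x₂)) ≤ finrank K (LinearMap.range (F₂ x)) := by
  -- On the line `x₁ + t (x₂ - x₁)` each condition fails for finitely many `t` only.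
  have hf₁ := finite_setOf_finrank_range_lt (F₁ x₁) (F₁ (x₂ - x₁))
  have hf₂ := (finite_setOf_finrank_range_lt (F₂ x₂) (F₂ (x₂ - x₁))).image (· + 1)
  obtain ⟨t, ht⟩ := (hf₁.union hf₂).exists_notMem
  rw [Set.mem_union, not_or] at ht
  refine ⟨x₁ + t • (x₂ - x₁), V.add_mem h₁ (V.smul_mem t (V.sub_mem h₂ h₁)), ?_, ?_⟩
  · rw [map_add, map_smul]
    exact not_lt.mp ht.1
  · by_contra hlt
    refine ht.2 ⟨t - 1, ?_, sub_add_cancel t 1⟩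
    have h3 : x₂ + (t - 1) • (x₂ - x₁) = x₁ + t • (x₂ - x₁) := by module
    rw [← h3, map_add, map_smul, not_le] at hlt
    exact hlt

end LinearAlgebra

/-! ### The theorems of Green and Macaulay for small codimension -/

section Green

variable {K S : Type*} [Field K] [CommRing S] [Algebra K S]

/-- `GreenBound V d B` says that for every subspace `W` of the forms of degree `d + 1`, of
codimension `H`, there is a linear form modulo which the codimension of `W` drops to at most
`B H`. Here `V` is the space of linear forms, and `V ^ d` the space of forms of degree `d`. -/
def GreenBound (V : Submodule K S) (d : ℕ) (B : ℕ → ℕ) : Prop :=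
  ∀ W ≤ V ^ (d + 1), ∃ x ∈ V,
    codim (W ⊔ (V ^ d).map (LinearMap.mulLeft K x)) (V ^ (d + 1)) ≤ B (codim W (V ^ (d + 1)))

variable {V : Submodule K S}

theorem map_mulLeft_pow_le {x : S} (hx : x ∈ V) (d : ℕ) :
    (V ^ d).map (LinearMap.mulLeft K x) ≤ V ^ (d + 1) := by
  rw [Submodule.map_le_iff_le_comap, pow_succ']
  exact fun p hp => Submodule.mul_mem_mul hx hp

theorem finiteDimensional_pow [FiniteDimensional K V] (d : ℕ) :
    FiniteDimensional K ↥(V ^ d) :=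
  Module.Finite.iff_fg.mpr ((Module.Finite.iff_fg.mp inferInstance).pow d)

theorem greenBound_zero [FiniteDimensional K V] : GreenBound V 0 (· - 1) := by
  intro W hW
  have := finiteDimensional_pow (V := V) 1
  by_cases h : V ≤ W
  · refine ⟨0, V.zero_mem, ?_⟩
    have h0 : V ^ (0 + 1) ≤ W := by simpa using h
    rw [codim_eq_zero (h0.trans le_sup_left)]
    exact Nat.zero_le _
  · obtain ⟨x, hx, hxW⟩ := SetLike.not_le_iff_exists.mp h
    refine ⟨x, hx, ?_⟩
    have hx1 := map_mulLeft_pow_le hx 0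
    have h1 := codim_add_finrank hW
    have h2 := codim_add_finrank (sup_le hW hx1)
    have : FiniteDimensional K ↥(W ⊔ (V ^ 0).map (LinearMap.mulLeft K x)) :=
      Submodule.finiteDimensional_of_le (sup_le hW hx1)
    have hlt : W < W ⊔ (V ^ 0).map (LinearMap.mulLeft K x) := by
      refine lt_of_le_of_ne le_sup_left fun heq => hxW ?_
      rw [heq]
      refine Submodule.mem_sup_right ⟨1, ?_, by simp⟩
      rw [pow_zero]
      exact Submodule.one_le.mp le_rfl
    have h3 := Submodule.finrank_lt_finrank_of_lt hlt
    dsimp only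
    omega

/-- Simultaneous genericity: a single linear form is as good for `W₁` as `x₁` is, and as good for
`W₂` as `x₂` is. -/
theorem exists_codim_sup_le [Infinite K] [FiniteDimensional K V] {d₁ d₂ : ℕ}
    {W₁ W₂ : Submodule K S} (hW₁ : W₁ ≤ V ^ (d₁ + 1)) (hW₂ : W₂ ≤ V ^ (d₂ + 1)) {x₁ x₂ : S}
    (h₁ : x₁ ∈ V) (h₂ : x₂ ∈ V) :
    ∃ x ∈ V,
      codim (W₁ ⊔ (V ^ d₁).map (LinearMap.mulLeft K x)) (V ^ (d₁ + 1)) ≤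
        codim (W₁ ⊔ (V ^ d₁).map (LinearMap.mulLeft K x₁)) (V ^ (d₁ + 1)) ∧
      codim (W₂ ⊔ (V ^ d₂).map (LinearMap.mulLeft K x)) (V ^ (d₂ + 1)) ≤
        codim (W₂ ⊔ (V ^ d₂).map (LinearMap.mulLeft K x₂)) (V ^ (d₂ + 1)) := by
  have := finiteDimensional_pow (V := V)
  let F (W : Submodule K S) (d : ℕ) : S →ₗ[K] ↥(V ^ d) →ₗ[K] S ⧸ W :=
    ((LinearMap.mul K S).compr₂ W.mkQ).compl₂ (V ^ d).subtype
  have hF (W : Submodule K S) (d : ℕ) (x : S) :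
      LinearMap.range (F W d x) = (V ^ d).map (W.mkQ ∘ₗ LinearMap.mulLeft K x) := by
    rw [← LinearMap.range_domRestrict]
    rfl
  obtain ⟨x, hx, hle₁, hle₂⟩ := exists_finrank_range_ge (F W₁ d₁) (F W₂ d₂) h₁ h₂
  rw [hF, hF] at hle₁ hle₂
  have e₁ := codim_sup_map_add_finrank hW₁ _ _ (map_mulLeft_pow_le hx d₁)
  have e₂ := codim_sup_map_add_finrank hW₁ _ _ (map_mulLeft_pow_le h₁ d₁)
  have e₃ := codim_sup_map_add_finrank hW₂ _ _ (map_mulLeft_pow_le hx d₂)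
  have e₄ := codim_sup_map_add_finrank hW₂ _ _ (map_mulLeft_pow_le h₂ d₂)
  exact ⟨x, hx, by omega, by omega⟩

/-- The inductive step of Green's hyperplane restriction theorem. If `c` is the codimension of a
general hyperplane restriction of a subspace `W` of codimension `H`, then `W : x` has codimension
`H - c`, and restricting `W : x` and `W + x V ^ d` once more bounds `c` by `B' (H - c) + B c`. -/
theorem GreenBound.succ [Infinite K] [FiniteDimensional K V] {d : ℕ} {B' B : ℕ → ℕ}
    (hB' : GreenBound V d B')
    (hB : ∀ H c, 1 ≤ c → c < H → c ≤ B' (H - c) + B c → c ≤ B H) :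
    GreenBound V (d + 1) B := by
  have := finiteDimensional_pow (V := V)
  intro W hW
  induction hH : codim W (V ^ (d + 1 + 1)) using Nat.strong_induction_on generalizing W with
  | _ H ih =>
  -- The linear form `x` minimizes the codimension `c` of the restriction of `W`.
  obtain ⟨x, hx, hmin⟩ : ∃ x ∈ V, ∀ y ∈ V,
      codim (W ⊔ (V ^ (d + 1)).map (LinearMap.mulLeft K x)) (V ^ (d + 1 + 1)) ≤
        codim (W ⊔ (V ^ (d + 1)).map (LinearMap.mulLeft K y)) (V ^ (d + 1 + 1)) :=
    (measure fun y => codim (W ⊔ (V ^ (d + 1)).map (LinearMap.mulLeft K y))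
      (V ^ (d + 1 + 1))).wf.has_min (V : Set S) ⟨0, V.zero_mem⟩ |>.imp
        fun _ h => ⟨h.1, fun y hy => not_lt.mp (h.2 y hy)⟩
  have hxV := map_mulLeft_pow_le hx (d + 1)
  set W₁ := W ⊔ (V ^ (d + 1)).map (LinearMap.mulLeft K x) with hW₁
  have hW₁V : W₁ ≤ V ^ (d + 1 + 1) := sup_le hW hxV
  set c := codim W₁ (V ^ (d + 1 + 1)) with hc
  refine ⟨x, hx, ?_⟩
  rcases Nat.eq_zero_or_pos c with hc0 | hc0
  · rw [← hW₁, ← hc, hc0]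
    exact Nat.zero_le _
  have hcH : c < H := by
    refine lt_of_le_of_ne (hH ▸ codim_anti le_sup_left) fun heq => ?_
    -- If `c = H`, then every linear form multiplies `V ^ (d + 1)` into `W`, so that `W` is
    -- everything.
    have hle : V ^ (d + 1 + 1) ≤ W := by
      rw [pow_succ' V (d + 1), Submodule.mul_le]
      intro y hy p hp
      have h1 := codim_sup_map_add_finrank hW _ _ (map_mulLeft_pow_le hy (d + 1))
      have h2 := hmin y hy
      have h3 : finrank K ((V ^ (d + 1)).map (W.mkQ ∘ₗ LinearMap.mulLeft K y)) = 0 := by omega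
      have h4 := Submodule.finrank_eq_zero.mp h3
      rw [← LinearMap.le_ker_iff_map] at h4
      simpa using h4 hp
    have := codim_eq_zero hle
    omega
  obtain ⟨x₁, hx₁, hle₁⟩ := ih c hcH W₁ hW₁V rfl
  set W₂ := V ^ (d + 1) ⊓ W.comap (LinearMap.mulLeft K x) with hW₂
  have hW₂V : W₂ ≤ V ^ (d + 1) := inf_le_left
  have hcW₂ : codim W₂ (V ^ (d + 1)) = H - c := by
    have h1 := codim_comap_add_codim_sup hW (LinearMap.mulLeft K x) (V ^ (d + 1)) hxV
    have h2 := codim_add_finrank hW₂V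
    have h3 := codim_add_finrank_inf (W.comap (LinearMap.mulLeft K x)) (V ^ (d + 1))
    rw [← hW₁, ← hc] at h1
    rw [← hW₂] at h3
    omega
  obtain ⟨x₂, hx₂, hle₂⟩ := hB' W₂ hW₂V
  obtain ⟨y, hy, hy₁, hy₂⟩ := exists_codim_sup_le hW₁V hW₂V hx₁ hx₂
  have hyV := map_mulLeft_pow_le hy (d + 1)
  set Wy := W ⊔ (V ^ (d + 1)).map (LinearMap.mulLeft K y) with hWy
  have hcy : c ≤ codim Wy (V ^ (d + 1 + 1)) := hmin y hy
  have hex := codim_comap_add_codim_sup (sup_le hW hyV : Wy ≤ _) (LinearMap.mulLeft K x)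
    (V ^ (d + 1)) hxV
  have h1 : Wy ⊔ (V ^ (d + 1)).map (LinearMap.mulLeft K x) =
      W₁ ⊔ (V ^ (d + 1)).map (LinearMap.mulLeft K y) := by
    rw [hWy, hW₁, sup_right_comm]
  have h2 : codim (Wy.comap (LinearMap.mulLeft K x)) (V ^ (d + 1)) ≤
      codim (W₂ ⊔ (V ^ d).map (LinearMap.mulLeft K y)) (V ^ (d + 1)) := by
    refine codim_anti (sup_le ?_ ?_)
    · exact inf_le_right.trans (Submodule.comap_mono le_sup_left)
    · rw [Submodule.map_le_iff_le_comap]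
      intro p hp
      refine Submodule.mem_sup_right ⟨x * p, ?_, mul_left_comm y x p⟩
      rw [pow_succ']
      exact Submodule.mul_mem_mul hx hp
  rw [h1, ← hWy] at hex
  rw [hcW₂] at hle₂
  exact hB H c hc0 hcH (by omega)

/-- Green's bound in degrees at least `2`, for codimension at most `7`; the trivial bound beyond. -/
def boundTwo (H : ℕ) : ℕ :=
  if H ≤ 2 then 0 else if H ≤ 4 then 1 else if H ≤ 5 then 2 else if H ≤ 7 then 3 else H

/-- Green's bound in degrees at least `3`, for codimension at most `9`; the trivial bound beyond. -/
def boundThree (H : ℕ) : ℕ :=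
  if H ≤ 3 then 0 else if H ≤ 6 then 1 else if H ≤ 8 then 2 else if H ≤ 9 then 3 else H

/-- Green's bound in degrees at least `4`, for codimension at most `13`; the trivial bound
beyond. -/
def boundFour (H : ℕ) : ℕ :=
  if H ≤ 4 then 0 else if H ≤ 8 then 1 else if H ≤ 11 then 2 else if H ≤ 13 then 3 else H

theorem greenBound_sub_one [Infinite K] [FiniteDimensional K V] (d : ℕ) :
    GreenBound V d (· - 1) := by
  induction d with
  | zero => exact greenBound_zero
  | succ d ih => exact ih.succ fun H c _ _ _ => by omega

theorem greenBound_boundTwo [Infinite K] [FiniteDimensional K V] (d : ℕ) :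
    GreenBound V (d + 1) boundTwo := by
  refine (greenBound_sub_one d).succ fun H c h1 h2 h3 => ?_
  unfold boundTwo at *
  split_ifs at * <;> omega

theorem greenBound_boundThree [Infinite K] [FiniteDimensional K V] (d : ℕ) :
    GreenBound V (d + 2) boundThree := by
  refine (greenBound_boundTwo d).succ fun H c h1 h2 h3 => ?_
  unfold boundTwo boundThree at *
  split_ifs at * <;> omega

theorem greenBound_boundFour [Infinite K] [FiniteDimensional K V] (d : ℕ) :
    GreenBound V (d + 3) boundFour := by
  refine (greenBound_boundThree d).succ fun H c h1 h2 h3 => ?_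
  unfold boundThree boundFour at *
  split_ifs at * <;> omega

/-- A weak form of Macaulay's theorem: once a standard graded algebra has dimension at most `2` in
degree `2`, its dimension in later degrees does not exceed that. The graded pieces of the ideal in
degrees `2` to `N + 2` are `D 0, …, D N`. By Green's bound, the quotient by a general linear
form `x` vanishes from degree `2` on, so that multiplication by `x` is surjective there. -/
theorem codim_le_of_codim_le_two [Infinite K] [FiniteDimensional K V] (N : ℕ)
    (D : ℕ → Submodule K S) (hD : ∀ j, D j ≤ V ^ (j + 2)) (hV : ∀ j < N, V * D j ≤ D (j + 1))
    (h : codim (D 0) (V ^ 2) ≤ 2) : codim (D N) (V ^ (N + 2)) ≤ codim (D 0) (V ^ 2) := by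
  have := finiteDimensional_pow (V := V)
  obtain ⟨x, hx, hle⟩ := greenBound_boundTwo (V := V) 0 (D 0) (hD 0)
  have h0 : boundTwo (codim (D 0) (V ^ 2)) = 0 := if_pos h
  have htop0 : V ^ 2 ≤ D 0 ⊔ (V ^ 1).map (LinearMap.mulLeft K x) :=
    le_of_codim_eq_zero (Nat.le_zero.mp (hle.trans_eq h0))
  have htop : ∀ j ≤ N, V ^ (j + 2) ≤ D j ⊔ (V ^ (j + 1)).map (LinearMap.mulLeft K x) := by
    intro j
    induction j with
    | zero => exact fun _ => htop0
    | succ j ih =>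
      intro hj
      rw [show j + 1 + 2 = j + 2 + 1 by ring, pow_succ']
      refine (mul_le_mul_right (ih (by omega)) V).trans ?_
      rw [Submodule.mul_sup]
      refine sup_le_sup (hV j hj) ?_
      rw [Submodule.mul_le]
      rintro y hy _ ⟨p, hp, rfl⟩
      refine ⟨y * p, ?_, mul_left_comm x y p⟩
      rw [pow_succ']
      exact Submodule.mul_mem_mul hy hp
  have hstep : ∀ j ≤ N, codim (D j) (V ^ (j + 2)) ≤ codim (D 0) (V ^ 2) := by
    intro j
    induction j with
    | zero => exact fun _ => le_rfl
    | succ j ih =>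
      intro hj
      refine le_trans ?_ (ih (by omega))
      have h1 := codim_comap_add_codim_sup (hD (j + 1)) (LinearMap.mulLeft K x) (V ^ (j + 2))
        (map_mulLeft_pow_le hx (j + 2))
      rw [codim_eq_zero (htop (j + 1) hj), add_zero] at h1
      rw [← h1]
      exact codim_anti fun p hp => hV j hj (Submodule.mul_mem_mul hx hp)
  exact hstep N le_rfl

end Green

/-! ### The pairings defined by a functional -/

section Pairing

variable {K : Type*} [Field K] {n : ℕ}

instance finiteDimensional_homogeneousSubmodule (i : ℕ) :
    FiniteDimensional K ↥(homogeneousSubmodule (Fin n) K i) :=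
  Module.Finite.iff_fg.mpr (homogeneousSubmodule_fg (Fin n) K i)

theorem homogeneousSubmodule_eq_span (i : ℕ) :
    homogeneousSubmodule (Fin n) K i =
      Submodule.span K (Set.range fun m : {m : Fin n →₀ ℕ // m.degree = i} =>
        monomial (m : Fin n →₀ ℕ) (1 : K)) := by
  refine le_antisymm (fun p hp => ?_) ?_
  · rw [p.as_sum]
    refine Submodule.sum_mem _ fun m hm => ?_
    have hdeg : m.degree = i := by
      by_contra h
      exact mem_support_iff.mp hm (IsHomogeneous.coeff_eq_zero hp h)
    rw [← mul_one (coeff m p), ← smul_eq_mul, ← smul_monomial]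
    exact Submodule.smul_mem _ _ (Submodule.subset_span ⟨⟨m, hdeg⟩, rfl⟩)
  · rw [Submodule.span_le]
    rintro _ ⟨m, rfl⟩
    exact isHomogeneous_monomial 1 m.2

instance finite_exponents (i : ℕ) : Finite {m : Fin n →₀ ℕ // m.degree = i} :=
  Finsupp.finite_of_degree_eq i

/-- The forms of degree `i` that are orthogonal to all forms of degree `j` with respect to the
pairing `(p, q) ↦ φ (p q)` defined by a linear functional `φ`. For `j = e - i` and `φ` a form of
degree `e` in the divided power algebra, this is the degree `i` part of the annihilator of `φ`. -/
noncomputable def orth (φ : MvPolynomial (Fin n) K →ₗ[K] K) (i j : ℕ) :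
    Submodule K (MvPolynomial (Fin n) K) where
  carrier := {p | p ∈ homogeneousSubmodule (Fin n) K i ∧
    ∀ q ∈ homogeneousSubmodule (Fin n) K j, φ (p * q) = 0}
  add_mem' := fun {a b} ha hb => ⟨add_mem ha.1 hb.1, fun q hq => by
    rw [add_mul, map_add, ha.2 q hq, hb.2 q hq, add_zero]⟩
  zero_mem' := ⟨zero_mem _, fun q _ => by rw [zero_mul, map_zero]⟩
  smul_mem' := fun c a ha => ⟨Submodule.smul_mem _ c ha.1, fun q hq => by
    rw [smul_mul_assoc, map_smul, ha.2 q hq, smul_zero]⟩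

theorem orth_le (φ : MvPolynomial (Fin n) K →ₗ[K] K) (i j : ℕ) :
    orth φ i j ≤ homogeneousSubmodule (Fin n) K i :=
  fun _ hp => hp.1

/-- The rank of the pairing `(p, q) ↦ φ (p q)` on forms of degrees `i` and `j`. -/
noncomputable def pairingRank (φ : MvPolynomial (Fin n) K →ₗ[K] K) (i j : ℕ) : ℕ :=
  codim (orth φ i j) (homogeneousSubmodule (Fin n) K i)

/-- The rows of the catalecticant matrix of `φ`, the Gram matrix of the pairing
`(p, q) ↦ φ (p q)` on the monomials of degrees `i` and `j`. -/
noncomputable def catalecticant (φ : MvPolynomial (Fin n) K →ₗ[K] K) (i j : ℕ) :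
    {m : Fin n →₀ ℕ // m.degree = i} → {m : Fin n →₀ ℕ // m.degree = j} → K :=
  fun a b => φ (monomial (a + b : Fin n →₀ ℕ) 1)

theorem pairingRank_eq_finrank_span (φ : MvPolynomial (Fin n) K →ₗ[K] K) (i j : ℕ) :
    pairingRank φ i j = finrank K (Submodule.span K (Set.range (catalecticant φ i j))) := by
  let T : MvPolynomial (Fin n) K →ₗ[K] ({m : Fin n →₀ ℕ // m.degree = j} → K) :=
    LinearMap.pi fun b => φ ∘ₗ LinearMap.mulRight K (monomial (b : Fin n →₀ ℕ) 1)
  rw [pairingRank, codim_eq_finrank_map T]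
  · rw [homogeneousSubmodule_eq_span, Submodule.map_span, ← Set.range_comp]
    have hT : (T ∘ fun m : {m : Fin n →₀ ℕ // m.degree = i} =>
        monomial (m : Fin n →₀ ℕ) (1 : K)) = catalecticant φ i j := by
      funext a b
      simp [T, catalecticant, monomial_mul]
    rw [hT]
  · intro p hp
    constructor
    · intro h
      ext b
      exact h.2 _ (isHomogeneous_monomial 1 b.2)
    · intro h
      refine ⟨hp, fun q hq => ?_⟩
      have hle : homogeneousSubmodule (Fin n) K j ≤
          LinearMap.ker (φ ∘ₗ LinearMap.mulLeft K p) := by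
        rw [homogeneousSubmodule_eq_span, Submodule.span_le]
        rintro _ ⟨b, rfl⟩
        exact congrFun h b
      exact hle hq

theorem pairingRank_comm (φ : MvPolynomial (Fin n) K →ₗ[K] K) (i j : ℕ) :
    pairingRank φ i j = pairingRank φ j i := by
  have := fun i : ℕ => Fintype.ofFinite {m : Fin n →₀ ℕ // m.degree = i}
  rw [pairingRank_eq_finrank_span, pairingRank_eq_finrank_span]
  have h1 := (Matrix.of (catalecticant φ i j)).rank_eq_finrank_span_row
  have h2 := (Matrix.of (catalecticant φ j i)).rank_eq_finrank_span_row
  have h3 : (Matrix.of (catalecticant φ i j)).transpose = Matrix.of (catalecticant φ j i) := by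
    ext a b
    simp [catalecticant, add_comm]
  rw [← h3, Matrix.rank_transpose, h3] at h2
  exact h1.symm.trans h2

/-- The extension of scalars of a functional on the polynomial ring. -/
noncomputable def extendFunctional (L : Type*) [Field L] [Algebra K L]
    (φ : MvPolynomial (Fin n) K →ₗ[K] K) : MvPolynomial (Fin n) L →ₗ[L] L :=
  (basisMonomials (Fin n) L).constr L fun m => algebraMap K L (φ (monomial m 1))

theorem extendFunctional_monomial (L : Type*) [Field L] [Algebra K L]
    (φ : MvPolynomial (Fin n) K →ₗ[K] K) (m : Fin n →₀ ℕ) :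
    extendFunctional L φ (monomial m 1) = algebraMap K L (φ (monomial m 1)) := by
  have h := (basisMonomials (Fin n) L).constr_basis L
    (fun m => algebraMap K L (φ (monomial m 1))) m
  rwa [coe_basisMonomials] at h

/-- The dimension of the row space of a matrix does not change under a field extension. -/
theorem finrank_span_range_algebraMap_comp (L : Type*) [Field L] [Algebra K L] {ι κ : Type*}
    [Finite ι] [Finite κ] (v : ι → κ → K) :
    finrank L (Submodule.span L (Set.range fun i => algebraMap K L ∘ v i)) =
      finrank K (Submodule.span K (Set.range v)) := by
  obtain ⟨ι', a, ha, hspan, hind⟩ := exists_linearIndependent' K v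
  have : Finite ι' := Finite.of_injective a ha
  have := Fintype.ofFinite ι'
  have hind' : LinearIndependent L (fun i => algebraMap K L ∘ (v ∘ a) i) :=
    linearIndependent_algebraMap_comp_iff.mpr hind
  rw [← hspan, finrank_span_eq_card hind, ← finrank_span_eq_card hind']
  have key : Submodule.span L (Set.range fun i => algebraMap K L ∘ v i) =
      Submodule.span L (Set.range fun i => algebraMap K L ∘ (v ∘ a) i) := by
    refine le_antisymm ?_ (Submodule.span_mono ?_)
    · rw [Submodule.span_le]
      rintro _ ⟨i, rfl⟩
      let g : (κ → K) →ₗ[K] (κ → L) := (Algebra.linearMap K L).compLeft κ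
      have hi : v i ∈ Submodule.span K (Set.range (v ∘ a)) :=
        hspan ▸ Submodule.subset_span ⟨i, rfl⟩
      have hle : Submodule.span K (Set.range (v ∘ a)) ≤
          ((Submodule.span L (Set.range fun i => algebraMap K L ∘ (v ∘ a) i)).restrictScalars
            K).comap g := by
        rw [Submodule.span_le]
        rintro _ ⟨i', rfl⟩
        exact Submodule.subset_span ⟨i', rfl⟩
      exact hle hi
    · rintro _ ⟨i, rfl⟩
      exact ⟨a i, rfl⟩
  rw [key]

theorem pairingRank_extendFunctional (L : Type*) [Field L] [Algebra K L]
    (φ : MvPolynomial (Fin n) K →ₗ[K] K) (i j : ℕ) :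
    pairingRank (extendFunctional L φ) i j = pairingRank φ i j := by
  rw [pairingRank_eq_finrank_span, pairingRank_eq_finrank_span]
  have h : (catalecticant (extendFunctional L φ) i j) =
      fun a => algebraMap K L ∘ catalecticant φ i j a := by
    funext a b
    simp [catalecticant, extendFunctional_monomial]
  rw [h, finrank_span_range_algebraMap_comp]

theorem mul_orth_le (φ : MvPolynomial (Fin n) K →ₗ[K] K) (i j : ℕ) :
    homogeneousSubmodule (Fin n) K 1 * orth φ i (j + 1) ≤ orth φ (i + 1) j := by
  rw [Submodule.mul_le]
  intro x hx p hp
  refine ⟨add_comm i 1 ▸ IsHomogeneous.mul hx hp.1, fun q hq => ?_⟩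
  rw [mul_comm x p, mul_assoc]
  exact hp.2 _ (add_comm j 1 ▸ IsHomogeneous.mul hx hq)

/-- Multiplication by a linear form `x` from degree `i` to degree `i + 1` of the algebra defined
by `φ` has the rank of the pairing defined by the contraction `p ↦ φ (x p)`. -/
theorem pairingRank_contract_add_codim (φ : MvPolynomial (Fin n) K →ₗ[K] K) (i j : ℕ)
    {x : MvPolynomial (Fin n) K} (hx : x ∈ homogeneousSubmodule (Fin n) K 1) :
    pairingRank (φ ∘ₗ LinearMap.mulLeft K x) i j +
      codim (orth φ (i + 1) j ⊔ (homogeneousSubmodule (Fin n) K i).map (LinearMap.mulLeft K x))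
        (homogeneousSubmodule (Fin n) K (i + 1)) = pairingRank φ (i + 1) j := by
  have hx' := map_mulLeft_pow_le (V := homogeneousSubmodule (Fin n) K 1) hx i
  rw [homogeneousSubmodule_one_pow, homogeneousSubmodule_one_pow] at hx'
  rw [pairingRank, pairingRank, ← codim_comap_add_codim_sup (orth_le φ (i + 1) j) _ _ hx']
  congr 1
  have h1 := codim_add_finrank_inf (orth (φ ∘ₗ LinearMap.mulLeft K x) i j)
    (homogeneousSubmodule (Fin n) K i)
  have h2 := codim_add_finrank_inf ((orth φ (i + 1) j).comap (LinearMap.mulLeft K x))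
    (homogeneousSubmodule (Fin n) K i)
  have h3 : homogeneousSubmodule (Fin n) K i ⊓ orth (φ ∘ₗ LinearMap.mulLeft K x) i j =
      homogeneousSubmodule (Fin n) K i ⊓ (orth φ (i + 1) j).comap (LinearMap.mulLeft K x) := by
    ext p
    refine and_congr_right fun hp => ⟨fun h => ⟨hx' ⟨p, hp, rfl⟩, fun q hq => ?_⟩,
      fun h => ⟨hp, fun q hq => ?_⟩⟩
    · simpa [mul_assoc] using h.2 q hq
    · simpa [mul_assoc] using h.2 q hq
  rw [h3] at h1
  omega

/-- The symmetry of the pairing makes the ranks of a multiplication map in complementary degrees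
agree; so the entry in degree `2` exceeds the one in degree `1` as soon as the quotient by a linear
form `x` has at least as large a dimension in degree `2` as in degree `e - 1 = t + 3`. For a
general `x` the latter is at most `3` by Green's bound, and Macaulay's theorem excludes growth from
a dimension smaller than `3` in degree `2`. -/
theorem pairingRank_one_le_pairingRank_two [Infinite K] (φ : MvPolynomial (Fin n) K →ₗ[K] K)
    (t : ℕ) {B : ℕ → ℕ} (hB : GreenBound (homogeneousSubmodule (Fin n) K 1) (t + 2) B)
    (h3 : B (pairingRank φ 1 (t + 3)) ≤ 3) :
    pairingRank φ 1 (t + 3) ≤ pairingRank φ 2 (t + 2) := by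
  obtain ⟨x, hx, hle⟩ := hB (orth φ (t + 3) 1) (by simpa using orth_le φ (t + 3) 1)
  simp only [homogeneousSubmodule_one_pow] at hle
  rw [show t + 2 + 1 = t + 3 from rfl] at hle
  have hs1 := pairingRank_comm φ 1 (t + 3)
  have hs2 := pairingRank_comm (φ ∘ₗ LinearMap.mulLeft K x) 1 (t + 2)
  have he1 := pairingRank_contract_add_codim φ 1 (t + 2) hx
  have he2 := pairingRank_contract_add_codim φ (t + 2) 1 hx
  rw [← pairingRank, ← hs1] at hle
  let D (j : ℕ) : Submodule K (MvPolynomial (Fin n) K) :=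
    orth φ (j + 2) (t + 2 - j) ⊔
      (homogeneousSubmodule (Fin n) K (j + 1)).map (LinearMap.mulLeft K x)
  have hxV (j : ℕ) : (homogeneousSubmodule (Fin n) K j).map (LinearMap.mulLeft K x) ≤
      homogeneousSubmodule (Fin n) K (j + 1) := by
    simpa using map_mulLeft_pow_le (V := homogeneousSubmodule (Fin n) K 1) hx j
  have hmac (h2 : codim (D 0) (homogeneousSubmodule (Fin n) K 2) ≤ 2) :
      codim (D (t + 1)) (homogeneousSubmodule (Fin n) K (t + 1 + 2)) ≤
        codim (D 0) (homogeneousSubmodule (Fin n) K 2) := by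
    have := codim_le_of_codim_le_two (V := homogeneousSubmodule (Fin n) K 1) (t + 1) D
    simp only [homogeneousSubmodule_one_pow] at this
    refine this (fun j => sup_le (orth_le _ _ _) (hxV (j + 1))) (fun j hj => ?_) h2
    rw [Submodule.mul_sup]
    refine sup_le_sup ?_ ?_
    · rw [show t + 2 - j = t + 2 - (j + 1) + 1 by omega]
      exact mul_orth_le φ (j + 2) (t + 2 - (j + 1))
    · rw [Submodule.mul_le]
      rintro y hy _ ⟨p, hp, rfl⟩
      refine ⟨y * p, ?_, mul_left_comm x y p⟩
      exact add_comm 1 (j + 1) ▸ IsHomogeneous.mul hy hp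
  have hD : D (t + 1) = orth φ (t + 2 + 1) 1 ⊔
      (homogeneousSubmodule (Fin n) K (t + 2)).map (LinearMap.mulLeft K x) := by
    simp only [D]
    rw [show t + 2 - (t + 1) = 1 by omega]
  rw [hD] at hmac
  change codim (D 0) _ ≤ 2 → codim _ (homogeneousSubmodule (Fin n) K (t + 2 + 1)) ≤ _ at hmac
  change _ + codim (D 0) (homogeneousSubmodule (Fin n) K 2) = pairingRank φ 2 (t + 2) at he1
  change _ = pairingRank φ (t + 3) 1 at he2
  change codim _ (homogeneousSubmodule (Fin n) K (t + 2 + 1)) ≤ _ at hle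
  by_cases h2 : codim (D 0) (homogeneousSubmodule (Fin n) K 2) ≤ 2
  · have := hmac h2
    omega
  · have : codim (orth φ (t + 2 + 1) 1 ⊔
      (homogeneousSubmodule (Fin n) K (t + 2)).map (LinearMap.mulLeft K x))
        (homogeneousSubmodule (Fin n) K (t + 2 + 1)) ≤ 3 := hle.trans h3
    omega

/-- Passing to the algebraic closure removes the assumption that the field is infinite. -/
theorem pairingRank_one_le_pairingRank_two_of_le_nine (φ : MvPolynomial (Fin n) K →ₗ[K] K)
    (t : ℕ) (h : pairingRank φ 1 (t + 3) ≤ 9) :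
    pairingRank φ 1 (t + 3) ≤ pairingRank φ 2 (t + 2) := by
  rw [← pairingRank_extendFunctional (AlgebraicClosure K)] at h
  rw [← pairingRank_extendFunctional (AlgebraicClosure K),
    ← pairingRank_extendFunctional (AlgebraicClosure K) φ 2]
  refine pairingRank_one_le_pairingRank_two _ t (greenBound_boundThree t) ?_
  unfold boundThree
  split_ifs <;> omega

theorem pairingRank_one_le_pairingRank_two_of_le_thirteen
    (φ : MvPolynomial (Fin n) K →ₗ[K] K) (h : pairingRank φ 1 4 ≤ 13) :
    pairingRank φ 1 4 ≤ pairingRank φ 2 3 := by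
  rw [← pairingRank_extendFunctional (AlgebraicClosure K)] at h
  rw [← pairingRank_extendFunctional (AlgebraicClosure K),
    ← pairingRank_extendFunctional (AlgebraicClosure K) φ 2]
  refine pairingRank_one_le_pairingRank_two _ 1 (greenBound_boundFour 0) ?_
  unfold boundFour
  split_ifs <;> omega

end Pairing

variable {k : Type*} [Field k] {n : ℕ}

/-! ### Macaulay duality: from a Gorenstein algebra to a functional -/

section FromAlgebra

variable {I : Ideal (MvPolynomial (Fin n) k)}

theorem hilbertFunction_eq_codim {W : Submodule k (MvPolynomial (Fin n) k)} {i : ℕ}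
    (h : ∀ p ∈ homogeneousSubmodule (Fin n) k i, p ∈ W ↔ p ∈ I) :
    hilbertFunction I i = codim W (homogeneousSubmodule (Fin n) k i) := by
  rw [codim_eq_finrank_map (Ideal.Quotient.mkₐ k I).toLinearMap]
  · rfl
  · intro p hp
    rw [h p hp]
    exact Ideal.Quotient.eq_zero_iff_mem.symm

theorem hilbertFunction_eq_zero_iff {i : ℕ} :
    hilbertFunction I i = 0 ↔ ∀ p ∈ homogeneousSubmodule (Fin n) k i, p ∈ I := by
  rw [hilbertFunction_eq_codim (W := I.restrictScalars k) fun p _ => Iff.rfl]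
  exact ⟨fun h => le_of_codim_eq_zero h, fun h => codim_eq_zero h⟩

theorem hilbertFunction_zero_le : hilbertFunction I 0 ≤ 1 := by
  refine (Submodule.finrank_map_le _ _).trans ?_
  rw [homogeneousSubmodule_zero, Submodule.one_eq_span]
  exact (finrank_span_singleton one_ne_zero).le

theorem hilbertFunction_eq_zero_of_le {i j : ℕ} (hij : i ≤ j) (h : hilbertFunction I i = 0) :
    hilbertFunction I j = 0 := by
  rw [hilbertFunction_eq_zero_iff] at h ⊢
  have hle : homogeneousSubmodule (Fin n) k j ≤ I.restrictScalars k := by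
    rw [← homogeneousSubmodule_one_pow, ← Nat.add_sub_cancel' hij, pow_add,
      homogeneousSubmodule_one_pow, Submodule.mul_le]
    exact fun p hp q _ => I.mul_mem_right q (h p hp)
  exact hle

/-- In a Gorenstein algebra of socle degree `e` the socle is the component of degree `e`. -/
theorem IsArtinianGorenstein.gradedPiece_eq_socle (hI : IsArtinianGorenstein I) {e : ℕ}
    (he : 0 < hilbertFunction I e) (he' : hilbertFunction I (e + 1) = 0) :
    gradedPiece I e = socle I := by
  have : FiniteDimensional k (socle I) := Module.finite_of_finrank_eq_succ hI.socle_finrank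
  refine Submodule.eq_of_le_of_finrank_le ?_ (hI.socle_finrank.trans_le he)
  rintro _ ⟨p, hp, rfl⟩ j
  refine Ideal.Quotient.eq_zero_iff_mem.mpr (hilbertFunction_eq_zero_iff.mp he' _ ?_)
  exact add_comm 1 e ▸ (isHomogeneous_X k j).mul hp

/-- A form that is killed, modulo `I`, by all forms of complementary degree `j` lies in `I`: by
descending induction on its degree it is a socle element of degree less than `e`. -/
theorem IsArtinianGorenstein.mem_of_mul_mem (hI : IsArtinianGorenstein I) {e : ℕ}
    (he : 0 < hilbertFunction I e) (he' : hilbertFunction I (e + 1) = 0) (j : ℕ) :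
    ∀ (i : ℕ), i + j = e → ∀ p ∈ homogeneousSubmodule (Fin n) k i,
      (∀ q ∈ homogeneousSubmodule (Fin n) k j, p * q ∈ I) → p ∈ I := by
  induction j with
  | zero =>
    intro i _ p _ h
    simpa using h 1 (isHomogeneous_one _ _)
  | succ j ih =>
    intro i hij p hp h
    have hsoc : Ideal.Quotient.mk I p ∈ socle I := by
      intro a
      rw [← map_mul, Ideal.Quotient.eq_zero_iff_mem, mul_comm]
      refine ih (i + 1) (by omega) _ (IsHomogeneous.mul hp (isHomogeneous_X k a)) fun q hq => ?_
      rw [mul_assoc]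
      exact h _ (add_comm 1 j ▸ (isHomogeneous_X k a).mul hq)
    rw [← hI.gradedPiece_eq_socle he he'] at hsoc
    obtain ⟨q, hq, hqp⟩ := hsoc
    have hmem : q - p ∈ I := Ideal.Quotient.eq.mp hqp
    have hcomp := homogeneousComponent_mem_of_mem hI.homogeneous hmem i
    rw [map_sub, homogeneousComponent_of_mem hq, homogeneousComponent_of_mem hp,
      if_neg (by omega), if_pos rfl, zero_sub, neg_mem_iff] at hcomp
    exact hcomp

/-- Macaulay duality: the Hilbert function of a Gorenstein algebra of socle degree `e` consists of
the ranks of the pairings in complementary degrees that are defined by a functional on the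
polynomial ring. The functional is the projection to the socle. -/
theorem IsArtinianGorenstein.exists_functional (hI : IsArtinianGorenstein I) {e : ℕ}
    (he : 0 < hilbertFunction I e) (he' : hilbertFunction I (e + 1) = 0) :
    ∃ φ : MvPolynomial (Fin n) k →ₗ[k] k, ∀ i j, i + j = e →
      hilbertFunction I i = pairingRank φ i j := by
  have h1 : finrank k (gradedPiece I e) = 1 := by
    rw [hI.gradedPiece_eq_socle he he', hI.socle_finrank]
  have : FiniteDimensional k (gradedPiece I e) := Module.finite_of_finrank_eq_succ h1
  let u : gradedPiece I e ≃ₗ[k] k := LinearEquiv.ofFinrankEq _ _ (by rw [h1, finrank_self])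
  obtain ⟨π, hπ⟩ := (gradedPiece I e).subtype.exists_leftInverse_of_injective
    (gradedPiece I e).ker_subtype
  let φ : MvPolynomial (Fin n) k →ₗ[k] k :=
    u.toLinearMap ∘ₗ π ∘ₗ (Ideal.Quotient.mkₐ k I).toLinearMap
  have hφI : ∀ p ∈ I, φ p = 0 := fun p hp => by
    have : Ideal.Quotient.mkₐ k I p = 0 := Ideal.Quotient.eq_zero_iff_mem.mpr hp
    simp only [φ, LinearMap.comp_apply, AlgHom.toLinearMap_apply, this, map_zero]
  have hφ : ∀ p ∈ homogeneousSubmodule (Fin n) k e, φ p = 0 → p ∈ I := fun p hp h => by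
    have hmem : Ideal.Quotient.mkₐ k I p ∈ gradedPiece I e := ⟨p, hp, rfl⟩
    have h2 : π (Ideal.Quotient.mkₐ k I p) = ⟨_, hmem⟩ :=
      LinearMap.congr_fun hπ ⟨_, hmem⟩
    have h3 : u ⟨_, hmem⟩ = 0 := by rw [← h2]; exact h
    rw [map_eq_zero_iff u u.injective] at h3
    exact Ideal.Quotient.eq_zero_iff_mem.mp (congrArg Subtype.val h3)
  refine ⟨φ, fun i j hij => hilbertFunction_eq_codim fun p hp => ⟨fun h => ?_, fun h => ?_⟩⟩
  · exact hI.mem_of_mul_mem he he' j i hij p hp fun q hq =>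
      hφ _ (hij ▸ IsHomogeneous.mul hp hq) (h.2 q hq)
  · exact ⟨hp, fun q _ => hφI _ (I.mul_mem_right q h)⟩

end FromAlgebra

/-! ### Macaulay duality: from a functional to a Gorenstein algebra -/

section FromFunctional

/-- The ideal of the Gorenstein algebra with dual functional `φ`: the largest ideal on which `φ`
vanishes. -/
def annIdeal (φ : MvPolynomial (Fin n) k →ₗ[k] k) : Ideal (MvPolynomial (Fin n) k) where
  carrier := {p | ∀ q, φ (p * q) = 0}
  add_mem' := fun ha hb q => by rw [add_mul, map_add, ha q, hb q, add_zero]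
  zero_mem' := fun q => by rw [zero_mul, map_zero]
  smul_mem' := fun c p hp q => by rw [smul_eq_mul, mul_comm c p, mul_assoc]; exact hp _

variable {φ : MvPolynomial (Fin n) k →ₗ[k] k} {e : ℕ}

theorem mem_annIdeal {p : MvPolynomial (Fin n) k} : p ∈ annIdeal φ ↔ ∀ q, φ (p * q) = 0 :=
  Iff.rfl

theorem mem_annIdeal_of_forall_isHomogeneous {p : MvPolynomial (Fin n) k}
    (h : ∀ j, ∀ q ∈ homogeneousSubmodule (Fin n) k j, φ (p * q) = 0) : p ∈ annIdeal φ := by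
  intro q
  rw [← q.sum_homogeneousComponent, Finset.mul_sum, map_sum]
  exact Finset.sum_eq_zero fun j _ => h j _ (homogeneousComponent_mem j q)

/-- Functionals concentrated in degree `e`. -/
def IsFunctionalOfDegree (φ : MvPolynomial (Fin n) k →ₗ[k] k) (e : ℕ) : Prop :=
  ∀ j ≠ e, ∀ p ∈ homogeneousSubmodule (Fin n) k j, φ p = 0

theorem IsFunctionalOfDegree.apply_mul (hφ : IsFunctionalOfDegree φ e) {i j : ℕ} (hij : i + j = e)
    (p : MvPolynomial (Fin n) k) {q : MvPolynomial (Fin n) k}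
    (hq : q ∈ homogeneousSubmodule (Fin n) k j) :
    φ (p * q) = φ (homogeneousComponent i p * q) := by
  conv_lhs => rw [← p.sum_homogeneousComponent, Finset.sum_mul, map_sum]
  refine Finset.sum_eq_single i (fun b _ hb => ?_) fun hi => ?_
  · exact hφ (b + j) (by omega) _ (IsHomogeneous.mul (homogeneousComponent_mem b p) hq)
  · rw [homogeneousComponent_eq_zero, zero_mul, map_zero]
    simpa [Nat.lt_succ_iff] using hi

theorem IsFunctionalOfDegree.apply_homogeneousComponent (hφ : IsFunctionalOfDegree φ e)
    (p : MvPolynomial (Fin n) k) : φ (homogeneousComponent e p) = φ p := by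
  have h := hφ.apply_mul (add_zero e) p (isHomogeneous_one (Fin n) k)
  rw [mul_one, mul_one] at h
  exact h.symm

theorem IsFunctionalOfDegree.mem_annIdeal_of_lt (hφ : IsFunctionalOfDegree φ e) {i : ℕ}
    (hi : e < i) {p : MvPolynomial (Fin n) k} (hp : p ∈ homogeneousSubmodule (Fin n) k i) :
    p ∈ annIdeal φ :=
  mem_annIdeal_of_forall_isHomogeneous fun j _ hq =>
    hφ (i + j) (by omega) _ (IsHomogeneous.mul hp hq)

theorem IsFunctionalOfDegree.hilbertFunction_annIdeal (hφ : IsFunctionalOfDegree φ e) {i j : ℕ}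
    (hij : i + j = e) : hilbertFunction (annIdeal φ) i = pairingRank φ i j := by
  refine hilbertFunction_eq_codim fun p hp => ⟨fun h => ?_, fun h => ⟨hp, fun q _ => h q⟩⟩
  refine mem_annIdeal_of_forall_isHomogeneous fun j' q hq => ?_
  rcases eq_or_ne j' j with rfl | hj
  · exact h.2 q hq
  · exact hφ (i + j') (by omega) _ (IsHomogeneous.mul hp hq)

/-- On the preimage of the socle, `φ` only sees the constant term of a multiplier. -/
theorem apply_mul_of_X_mul_mem {p : MvPolynomial (Fin n) k}
    (hp : ∀ j, X j * p ∈ annIdeal φ) (q : MvPolynomial (Fin n) k) :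
    φ (p * q) = coeff 0 q * φ p := by
  induction q using MvPolynomial.induction_on with
  | C a => rw [mul_comm, ← smul_eq_C_mul, map_smul, coeff_C, if_pos rfl, smul_eq_mul]
  | add q₁ q₂ h₁ h₂ => rw [mul_add, map_add, h₁, h₂, coeff_add, add_mul]
  | mul_X q j _ =>
    have h := hp j q
    have h0 : coeff 0 (q * X j) = 0 := by
      classical
      rw [coeff_mul_X', if_neg (by simp)]
    rw [show p * (q * X j) = X j * p * q by ring, h, h0, zero_mul]

theorem IsFunctionalOfDegree.isArtinianGorenstein (hφ : IsFunctionalOfDegree φ e) (h0 : φ ≠ 0) :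
    IsArtinianGorenstein (annIdeal φ) where
  homogeneous := by
    intro i p hp
    have hdec : (DirectSum.decompose (homogeneousSubmodule (Fin n) k) p i :
        MvPolynomial (Fin n) k) = homogeneousComponent i p :=
      decomposition.decompose'_apply p i
    rw [hdec]
    refine mem_annIdeal_of_forall_isHomogeneous fun j q hq => ?_
    by_cases hij : i + j = e
    · rw [← hφ.apply_mul hij p hq]
      exact hp q
    · exact hφ (i + j) hij _ (IsHomogeneous.mul (homogeneousComponent_mem i p) hq)
  artinian := by
    -- The forms of degree at most `e` span the quotient.
    let T : Submodule k (MvPolynomial (Fin n) k) :=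
      ⨆ i : Fin (e + 1), homogeneousSubmodule (Fin n) k i
    have hsurj : Function.Surjective
        ((Ideal.Quotient.mkₐ k (annIdeal φ)).toLinearMap.domRestrict T) := by
      rw [← LinearMap.range_eq_top, LinearMap.range_domRestrict, eq_top_iff]
      rintro a -
      obtain ⟨p, rfl⟩ := Ideal.Quotient.mkₐ_surjective k (annIdeal φ) a
      rw [← p.sum_homogeneousComponent, map_sum]
      refine Submodule.sum_mem _ fun i _ => ?_
      by_cases hi : e < i
      · have hz : Ideal.Quotient.mkₐ k (annIdeal φ) (homogeneousComponent i p) = 0 :=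
          Ideal.Quotient.eq_zero_iff_mem.mpr
            (hφ.mem_annIdeal_of_lt hi (homogeneousComponent_mem i p))
        rw [hz]
        exact zero_mem _
      · exact ⟨_, Submodule.mem_iSup_of_mem (⟨i, by omega⟩ : Fin (e + 1))
          (homogeneousComponent_mem i p), rfl⟩
    have : Module.Finite k (MvPolynomial (Fin n) k ⧸ annIdeal φ) :=
      Module.Finite.of_surjective _ hsurj
    exact IsArtinianRing.of_finite k _
  socle_finrank := by
    obtain ⟨p, hp⟩ : ∃ p, φ p ≠ 0 := by
      by_contra! h
      exact h0 (LinearMap.ext h)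
    rw [← hφ.apply_homogeneousComponent p] at hp
    set s := homogeneousComponent e p with hs
    have hsX : ∀ j, X j * s ∈ annIdeal φ := fun j =>
      hφ.mem_annIdeal_of_lt (i := 1 + e) (by omega)
        ((isHomogeneous_X k j).mul (homogeneousComponent_mem e p))
    have hmem : Ideal.Quotient.mk (annIdeal φ) s ∈ socle (annIdeal φ) := fun j => by
      rw [← map_mul, Ideal.Quotient.eq_zero_iff_mem]
      exact hsX j
    refine finrank_eq_one (⟨_, hmem⟩ : socle (annIdeal φ)) (fun h => ?_) ?_
    · have h1 := Ideal.Quotient.eq_zero_iff_mem.mp (congrArg Subtype.val h) 1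
      rw [mul_one] at h1
      exact hp h1
    · rintro ⟨a, ha⟩
      obtain ⟨q, rfl⟩ := Ideal.Quotient.mk_surjective a
      refine ⟨φ q / φ s, Subtype.ext ?_⟩
      have hq : ∀ j, X j * q ∈ annIdeal φ := fun j => by
        have := ha j
        rwa [← map_mul, Ideal.Quotient.eq_zero_iff_mem] at this
      have hdiff : (φ q / φ s) • s - q ∈ annIdeal φ := fun r => by
        rw [sub_mul, map_sub, smul_mul_assoc, map_smul, apply_mul_of_X_mul_mem hq,
          apply_mul_of_X_mul_mem hsX, smul_eq_mul]
        field_simp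
        ring
      exact Ideal.Quotient.eq.mpr hdiff

/-- The functional `p ↦ ∑ₐ [xₐᵉ] p`, dual to the sum of the divided powers of degree `e`. -/
noncomputable def powerSumFunctional (k : Type*) [Field k] (r e : ℕ) :
    MvPolynomial (Fin r) k →ₗ[k] k :=
  ∑ a : Fin r, lcoeff k (Finsupp.single a e)

theorem powerSumFunctional_apply (r e : ℕ) (p : MvPolynomial (Fin r) k) :
    powerSumFunctional k r e p = ∑ a : Fin r, coeff (Finsupp.single a e) p := by
  simp [powerSumFunctional]

theorem isFunctionalOfDegree_powerSumFunctional (r e : ℕ) :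
    IsFunctionalOfDegree (powerSumFunctional k r e) e := by
  intro j hj p hp
  rw [powerSumFunctional_apply]
  exact Finset.sum_eq_zero fun a _ => IsHomogeneous.coeff_eq_zero hp (by simpa using hj.symm)

theorem powerSumFunctional_X_pow {r e : ℕ} (he : e ≠ 0) (a : Fin r) :
    powerSumFunctional k r e (X a ^ e) = 1 := by
  rw [powerSumFunctional_apply, Finset.sum_eq_single a]
  · rw [X_pow_eq_monomial, coeff_monomial, if_pos rfl]
  · intro b _ hb
    rw [X_pow_eq_monomial, coeff_monomial, if_neg]
    rw [Finsupp.single_left_inj he]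
    exact hb.symm
  · simp

/-- In degrees strictly between `0` and `e`, the algebra dual to a sum of `r` powers has the
powers of the `r` variables as a basis. -/
theorem pairingRank_powerSumFunctional (r : ℕ) {i j : ℕ} (hi : i ≠ 0) (hj : j ≠ 0) :
    pairingRank (powerSumFunctional k r (i + j)) i j = r := by
  let T : MvPolynomial (Fin r) k →ₗ[k] (Fin r → k) :=
    LinearMap.pi fun a => lcoeff k (Finsupp.single a i)
  have hT : ∀ p a, T p a = coeff (Finsupp.single a i) p := fun _ _ => rfl
  rw [pairingRank, codim_eq_finrank_map T]
  · have htop : (homogeneousSubmodule (Fin r) k i).map T = ⊤ := by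
      rw [eq_top_iff]
      rintro c -
      refine ⟨∑ a, c a • X a ^ i, Submodule.sum_mem _ fun a _ =>
        Submodule.smul_mem _ _ (isHomogeneous_X_pow a i), ?_⟩
      funext a
      rw [hT, coeff_sum, Finset.sum_eq_single a]
      · rw [coeff_smul, X_pow_eq_monomial, coeff_monomial, if_pos rfl, smul_eq_mul, mul_one]
      · intro b _ hb
        rw [coeff_smul, X_pow_eq_monomial, coeff_monomial, if_neg, smul_zero]
        rw [Finsupp.single_left_inj hi]
        exact hb
      · simp
    rw [htop, finrank_top, finrank_fin_fun]
  · intro p hp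
    constructor
    · intro h
      funext a
      have h1 := h.2 _ (isHomogeneous_X_pow a j)
      rw [powerSumFunctional_apply, X_pow_eq_monomial, Finset.sum_eq_single a] at h1
      · rw [Finsupp.single_add, coeff_mul_monomial, mul_one] at h1
        exact h1
      · intro b _ hb
        rw [coeff_mul_monomial', if_neg]
        intro hle
        have h2 := hle a
        rw [Finsupp.single_eq_same, Finsupp.single_eq_of_ne hb.symm] at h2
        omega
      · simp
    · intro h
      refine ⟨hp, fun q _ => ?_⟩
      rw [powerSumFunctional_apply]
      refine Finset.sum_eq_zero fun a _ => ?_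
      rw [coeff_mul]
      refine Finset.sum_eq_zero fun ⟨u, v⟩ huv => ?_
      -- A divisor `u` of a power of `x_a` is a power of `x_a`.
      have hu : u = Finsupp.single a (u a) := by
        replace huv := Finset.HasAntidiagonal.mem_antidiagonal.mp huv
        ext b
        rcases eq_or_ne b a with rfl | hb
        · simp
        · have h1 : u b + v b = Finsupp.single a (i + j) b := DFunLike.congr_fun huv b
          rw [Finsupp.single_eq_of_ne hb] at h1
          rw [Finsupp.single_eq_of_ne hb]
          omega
      by_cases hdeg : u.degree = i
      · rw [hu, Finsupp.degree_single] at hdeg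
        have h1 : coeff u p = 0 := by
          rw [hu, hdeg]
          exact congrFun h a
        rw [h1, zero_mul]
      · rw [IsHomogeneous.coeff_eq_zero hp hdeg, zero_mul]

/-- `(1, r, r, …, r, 1)` is a Gorenstein `h`-vector. -/
theorem exists_isGorensteinHVector {r e : ℕ} (hr : r ≠ 0) (he : 3 ≤ e) :
    ∃ h : ℕ → ℕ, IsGorensteinHVector k e h ∧ h 1 = r ∧ h 2 = r := by
  have hφ := isFunctionalOfDegree_powerSumFunctional (k := k) r e
  have hX := powerSumFunctional_X_pow (k := k) (e := e) (by omega)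
    (⟨0, Nat.pos_of_ne_zero hr⟩ : Fin r)
  refine ⟨hilbertFunction (annIdeal (powerSumFunctional k r e)),
    ⟨⟨r, _, hφ.isArtinianGorenstein fun h => ?_, fun i => rfl⟩, Nat.pos_of_ne_zero fun h => ?_,
      fun i hi => ?_⟩, ?_, ?_⟩
  · rw [h] at hX
    exact zero_ne_one hX
  · have h1 := hilbertFunction_eq_zero_iff.mp h _
      (isHomogeneous_X_pow (⟨0, Nat.pos_of_ne_zero hr⟩ : Fin r) e) 1
    rw [mul_one, hX] at h1
    exact one_ne_zero h1
  · exact hilbertFunction_eq_zero_iff.mpr fun p hp => hφ.mem_annIdeal_of_lt hi hp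
  · obtain ⟨j, rfl⟩ := Nat.exists_eq_add_of_le (show 1 ≤ e by omega)
    rw [hφ.hilbertFunction_annIdeal rfl]
    exact pairingRank_powerSumFunctional r one_ne_zero (by omega)
  · obtain ⟨j, rfl⟩ := Nat.exists_eq_add_of_le (show 2 ≤ e by omega)
    rw [hφ.hilbertFunction_annIdeal rfl]
    exact pairingRank_powerSumFunctional r two_ne_zero (by omega)

end FromFunctional

/-! ### Gorenstein h-vectors -/

section HVector

variable {h : ℕ → ℕ}

theorem IsGorensteinHVector.exists_functional {e : ℕ} (hh : IsGorensteinHVector k e h) :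
    ∃ (n : ℕ) (φ : MvPolynomial (Fin n) k →ₗ[k] k), ∀ i j, i + j = e → h i = pairingRank φ i j := by
  obtain ⟨⟨n, I, hI, hhI⟩, he, he'⟩ := hh
  obtain ⟨φ, hφ⟩ := hI.exists_functional (hhI e ▸ he) (hhI (e + 1) ▸ he' _ (Nat.lt_succ_self e))
  exact ⟨n, φ, fun i j hij => (hhI i).trans (hφ i j hij)⟩

theorem IsGorensteinHVector.symm {e : ℕ} (hh : IsGorensteinHVector k e h) {i j : ℕ}
    (hij : i + j = e) : h i = h j := by
  obtain ⟨n, φ, hφ⟩ := hh.exists_functional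
  rw [hφ i j hij, hφ j i (by omega), pairingRank_comm]

theorem IsGorensteinHVector.zero_le_one {e : ℕ} (hh : IsGorensteinHVector k e h) (he : 1 ≤ e) :
    h 0 ≤ h 1 := by
  obtain ⟨⟨n, I, hI, hhI⟩, hpos, -⟩ := hh
  rw [hhI 0]
  refine hilbertFunction_zero_le.trans (Nat.one_le_iff_ne_zero.mpr fun h1 => ?_)
  rw [hhI 1] at h1
  rw [hhI e, hilbertFunction_eq_zero_of_le he h1] at hpos
  exact lt_irrefl 0 hpos

theorem IsGorensteinHVector.one_le_two_of_le_nine {e : ℕ} (hh : IsGorensteinHVector k e h)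
    (he : 4 ≤ e) (h9 : h 1 ≤ 9) : h 1 ≤ h 2 := by
  obtain ⟨n, φ, hφ⟩ := hh.exists_functional
  obtain ⟨t, rfl⟩ := Nat.exists_eq_add_of_le he
  rw [hφ 1 (t + 3) (by omega)] at h9 ⊢
  rw [hφ 2 (t + 2) (by omega)]
  exact pairingRank_one_le_pairingRank_two_of_le_nine φ t h9

theorem IsGorensteinHVector.one_le_two_of_le_thirteen (hh : IsGorensteinHVector k 5 h)
    (h13 : h 1 ≤ 13) : h 1 ≤ h 2 := by
  obtain ⟨n, φ, hφ⟩ := hh.exists_functional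
  rw [hφ 1 4 rfl] at h13 ⊢
  rw [hφ 2 3 rfl]
  exact pairingRank_one_le_pairingRank_two_of_le_thirteen φ h13

theorem f_eq_self {r e : ℕ} (hr : r ≠ 0) (he : 3 ≤ e)
    (hle : ∀ h : ℕ → ℕ, IsGorensteinHVector k e h → h 1 = r → r ≤ h 2) : f k r e = r := by
  have hmem := exists_isGorensteinHVector (k := k) hr he
  refine le_antisymm (Nat.sInf_le hmem) (le_csInf ⟨r, hmem⟩ ?_)
  rintro m ⟨h, hh, h1, rfl⟩
  exact hle h hh h1

end HVector

end GorensteinHVector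

theorem corollary6 (k : Type*) [Field k] :
    ((∀ r e : ℕ, 2 ≤ r → r ≤ 9 → 4 ≤ e → GorensteinHVector.f k r e = r) ∧
      (∀ h : ℕ → ℕ, GorensteinHVector.IsGorensteinHVector k 4 h → h 1 ≤ 9 →
        GorensteinHVector.IsUnimodal 4 h)) ∧
    ((∀ r : ℕ, 2 ≤ r → r ≤ 13 → GorensteinHVector.f k r 5 = r) ∧
      (∀ h : ℕ → ℕ, GorensteinHVector.IsGorensteinHVector k 5 h → h 1 ≤ 13 →
        GorensteinHVector.IsUnimodal 5 h)) := by
  refine ⟨⟨fun r e hr hr9 he => ?_, fun h hh h9 => ?_⟩, fun r hr hr13 => ?_, fun h hh h13 => ?_⟩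
  · exact GorensteinHVector.f_eq_self (by omega) (by omega) fun h hh h1 =>
      h1 ▸ hh.one_le_two_of_le_nine he (by omega)
  · intro i j hij hj hlt
    have h01 := hh.zero_le_one (by norm_num)
    have h12 := hh.one_le_two_of_le_nine le_rfl h9
    have h04 := hh.symm (show 0 + 4 = 4 from rfl)
    have h13 := hh.symm (show 1 + 3 = 4 from rfl)
    interval_cases j <;> interval_cases i <;> simp only [Nat.reduceAdd] at hlt ⊢ <;> omega
  · exact GorensteinHVector.f_eq_self (by omega) (by omega) fun h hh h1 =>
      h1 ▸ hh.one_le_two_of_le_thirteen (by omega)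
  · intro i j hij hj hlt
    have h01 := hh.zero_le_one (by norm_num)
    have h12 := hh.one_le_two_of_le_thirteen h13
    have h05 := hh.symm (show 0 + 5 = 5 from rfl)
    have h14 := hh.symm (show 1 + 4 = 5 from rfl)
    have h23 := hh.symm (show 2 + 3 = 5 from rfl)
    interval_cases j <;> interval_cases i <;> simp only [Nat.reduceAdd] at hlt ⊢ <;> omega
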